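/- Let $M$ be a positive integer and let $U(M)$ be the group of unitary $M\times M$ complex matrices, with Lie algebra $\mathfrak u(M)$ of skew-Hermitian matrices. Equip $U(M)$ with the bi-invariant Riemannian metric which on $\mathfrak u(M)$ is $\langle u,v\rangle=\tfrac12\operatorname{tr}(u^\dagger v+v^\dagger u)$, so that $\|u\|=\sqrt{\langle u,u\rangle}$ is the Frobenius norm. Let $\ell$ denote the length of a piecewise $C^1$ curve in $U(M)$, and let $d(p,q)$ be the infimum of the lengths of all piecewise $C^1$ curves in $U(M)$ joining $p$ to $q$. A matrix $w=iK$ is called a principal logarithm of a unitary matrix $g$ if $K^\dagger=K$, $\exp(iK)=g$, and all eigenvalues of $K$ lie in $(-\pi,\pi]$. Let $p,q\in U(M)$ and let $w$ be a principal logarithm of $qp^{-1}$. Then the curve $$\gamma:[0,1]\to U(M),\qquad \gamma(t)=\exp(wt)\,p,$$ is a minimal geodesic segment joining $p$ to $q$; that is, $\gamma(0)=p$, $\gamma(1)=q$, $\gamma$ is a geodesic (it is smooth and the covariant derivative $\frac{D}{dt}\frac{d\gamma}{dt}$ vanishes on $[0,1]$), and $$d(\gamma(0),\gamma(t))=\ell(\gamma|_{[0,t]})\qquad\text{for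 every } t\in[0,1].$$ Moreover, $d(p,q)=\|w\|$. -/

import Mathlib

open Matrix Set
open scoped ContDiff

-- Matrices carry the Frobenius norm `‖u‖ = √(∑ |u i j|²)` throughout.
attribute [local instance] Matrix.frobeniusNormedAddCommGroup Matrix.frobeniusNormedSpace
  Matrix.frobeniusNormedRing Matrix.frobeniusNormedAlgebra

namespace UnitaryGeodesic

/-- The unitary group `U(M)`, regarded as an embedded submanifold of `Matrix (Fin M) (Fin M) ℂ`. -/
abbrev U (M : ℕ) := Matrix.unitaryGroup (Fin M) ℂ

/-- The Lie algebra `𝔲(M)`: the real vector space of skew-Hermitian matrices. -/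
noncomputable abbrev LieU (M : ℕ) : Submodule ℝ (Matrix (Fin M) (Fin M) ℂ) :=
  skewAdjoint.submodule ℝ (Matrix (Fin M) (Fin M) ℂ)

variable {M : ℕ}

/-- The inner product `⟨u, v⟩ = ½ tr (u† v + v† u)` (this trace is real). -/
noncomputable def lieInner (u v : Matrix (Fin M) (Fin M) ℂ) : ℝ :=
  ((1 / 2 : ℂ) * (uᴴ * v + vᴴ * u).trace).re

/-- The tangent space of `U(M)` at `p`, namely `𝔲(M) p`, inside the ambient matrix space. -/
noncomputable def tangentSpace (p : U M) : Submodule ℝ (Matrix (Fin M) (Fin M) ℂ) :=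
  (LieU M).map (LinearMap.mulRight ℝ (p : Matrix (Fin M) (Fin M) ℂ))

/-- The Riemannian metric at `p`: tangent vectors are translated to the identity from the right,
where they are paired by `lieInner`. It is meant for `X Y ∈ tangentSpace p`. -/
noncomputable def metric (p : U M) (X Y : Matrix (Fin M) (Fin M) ℂ) : ℝ :=
  lieInner (X * ((p⁻¹ : U M) : Matrix (Fin M) (Fin M) ℂ))
    (Y * ((p⁻¹ : U M) : Matrix (Fin M) (Fin M) ℂ))

/-- A curve in `U(M)`, seen as a curve of matrices. -/
def toMat (γ : ℝ → U M) (t : ℝ) : Matrix (Fin M) (Fin M) ℂ := γ t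

/-- `γ` restricted to `[a, b]` is a piecewise `C¹` curve: it is continuous, and `C¹` (up to the
end points) on each interval of some subdivision `a = τ 0 ≤ τ 1 ≤ ⋯ ≤ τ n = b`. -/
def IsPiecewiseC1 (γ : ℝ → U M) (a b : ℝ) : Prop :=
  ContinuousOn (toMat γ) (Icc a b) ∧
    ∃ (n : ℕ) (τ : ℕ → ℝ), Monotone τ ∧ τ 0 = a ∧ τ n = b ∧
      ∀ i < n, ContDiffOn ℝ 1 (toMat γ) (Icc (τ i) (τ (i + 1)))

/-- The length of `γ` restricted to `[a, b]`. -/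
noncomputable def length (γ : ℝ → U M) (a b : ℝ) : ℝ :=
  ∫ t in a..b, √(metric (γ t) (deriv (toMat γ) t) (deriv (toMat γ) t))

/-- The Riemannian distance: the infimum of the lengths of the piecewise `C¹` curves in `U(M)`
that join `p` to `q`. -/
noncomputable def riemDist (p q : U M) : ℝ :=
  sInf {L : ℝ | ∃ (γ : ℝ → U M) (a b : ℝ), a ≤ b ∧ IsPiecewiseC1 γ a b ∧
    γ a = p ∧ γ b = q ∧ L = length γ a b}

/-- The orthogonal projection of the ambient matrix space onto `tangentSpace p`. -/
noncomputable def tangentProj (p : U M) (X : Matrix (Fin M) (Fin M) ℂ) :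
    Matrix (Fin M) (Fin M) ℂ :=
  (1 / 2 : ℝ) • (X - p * Xᴴ * p)

/-- The covariant derivative `DV/dt` along the curve `γ : [a, b] → U(M)` of a vector field `V`.
The metric is the one induced by the Euclidean inner product of the matrix space, hence the
Levi-Civita derivative is the tangential component of the ambient derivative. -/
noncomputable def covDeriv (γ : ℝ → U M) (a b : ℝ) (V : ℝ → Matrix (Fin M) (Fin M) ℂ) (t : ℝ) :
    Matrix (Fin M) (Fin M) ℂ :=
  tangentProj (γ t) (derivWithin V (Icc a b) t)

/-- `γ : [a, b] → U(M)` is a geodesic: a smooth curve with `D/dt (dγ/dt) = 0`. -/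
def IsGeodesic (γ : ℝ → U M) (a b : ℝ) : Prop :=
  ContDiffOn ℝ ∞ (toMat γ) (Icc a b) ∧
    ∀ t ∈ Icc a b, covDeriv γ a b (fun s => derivWithin (toMat γ) (Icc a b) s) t = 0

/-- `γ : [0, 1] → U(M)` is a minimal geodesic segment from `p` to `q`. -/
def IsMinimalGeodesicSegment (γ : ℝ → U M) (p q : U M) : Prop :=
  γ 0 = p ∧ γ 1 = q ∧ IsGeodesic γ 0 1 ∧
    ∀ t ∈ Icc (0 : ℝ) 1, riemDist (γ 0) (γ t) = length γ 0 t

/-- `w` is a principal logarithm of `g`: `w = iK` with `K` Hermitian, `exp (iK) = g`, and all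
eigenvalues of `K` in `(-π, π]`. -/
def IsPrincipalLog (w : LieU M) (g : U M) : Prop :=
  ∃ (K : Matrix (Fin M) (Fin M) ℂ) (hK : K.IsHermitian),
    (w : Matrix (Fin M) (Fin M) ℂ) = Complex.I • K ∧
    NormedSpace.exp (Complex.I • K) = (g : Matrix (Fin M) (Fin M) ℂ) ∧
    ∀ i, hK.eigenvalues i ∈ Ioc (-Real.pi) Real.pi

theorem exp_mem_unitaryGroup (w : LieU M) (t : ℝ) :
    NormedSpace.exp (t • (w : Matrix (Fin M) (Fin M) ℂ)) ∈ Matrix.unitaryGroup (Fin M) ℂ := by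
  have hw : (w : Matrix (Fin M) (Fin M) ℂ)ᴴ = -(w : Matrix (Fin M) (Fin M) ℂ) := w.2
  have h : (t • (w : Matrix (Fin M) (Fin M) ℂ))ᴴ = -(t • (w : Matrix (Fin M) (Fin M) ℂ)) := by
    rw [Matrix.conjTranspose_smul, hw]; simp
  rw [Matrix.mem_unitaryGroup_iff, Matrix.star_eq_conjTranspose, ← Matrix.exp_conjTranspose, h,
    ← Matrix.exp_add_of_commute _ _
      (Commute.refl (t • (w : Matrix (Fin M) (Fin M) ℂ))).neg_right,
    add_neg_cancel, NormedSpace.exp_zero]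

/-- The curve `t ↦ exp (w t) p` in `U(M)`. -/
noncomputable def expCurve (w : LieU M) (p : U M) (t : ℝ) : U M :=
  ⟨NormedSpace.exp (t • (w : Matrix (Fin M) (Fin M) ℂ)), exp_mem_unitaryGroup w t⟩ * p

/-! Facts that justify the definitions above. -/

theorem lieInner_self (u : Matrix (Fin M) (Fin M) ℂ) : lieInner u u = ‖u‖ ^ 2 := by
  rw [Matrix.frobenius_norm_def, ← Real.sqrt_eq_rpow, Real.sq_sqrt (by positivity)]
  simp only [lieInner, Matrix.trace, Matrix.diag, Matrix.add_apply, Matrix.mul_apply,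
    Matrix.conjTranspose_apply]
  rw [Finset.sum_comm]
  simp only [← two_mul, ← Finset.mul_sum]
  rw [← mul_assoc]
  norm_num
  refine Finset.sum_congr rfl fun i _ => Finset.sum_congr rfl fun j _ => ?_
  rw [← Complex.normSq_eq_norm_sq, Complex.normSq_apply]

theorem mul_inv_self (p : U M) :
    (p : Matrix (Fin M) (Fin M) ℂ) * (p : Matrix (Fin M) (Fin M) ℂ)ᴴ = 1 :=
  Matrix.mem_unitaryGroup_iff.1 p.2

theorem inv_mul_self (p : U M) :
    (p : Matrix (Fin M) (Fin M) ℂ)ᴴ * (p : Matrix (Fin M) (Fin M) ℂ) = 1 :=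
  Matrix.mem_unitaryGroup_iff'.1 p.2

/-- The metric is induced by the Euclidean inner product of the matrix space. -/
theorem metric_eq (p : U M) (X Y : Matrix (Fin M) (Fin M) ℂ) : metric p X Y = lieInner X Y := by
  have key : ∀ A B : Matrix (Fin M) (Fin M) ℂ,
      ((A * ((p⁻¹ : U M) : Matrix (Fin M) (Fin M) ℂ))ᴴ *
        (B * ((p⁻¹ : U M) : Matrix (Fin M) (Fin M) ℂ))).trace = (Aᴴ * B).trace := by
    intro A B
    have h : ((p⁻¹ : U M) : Matrix (Fin M) (Fin M) ℂ) = (p : Matrix (Fin M) (Fin M) ℂ)ᴴ := rfl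
    rw [h, Matrix.conjTranspose_mul, Matrix.conjTranspose_conjTranspose, Matrix.mul_assoc,
      Matrix.trace_mul_comm, ← Matrix.mul_assoc, Matrix.mul_assoc, inv_mul_self, Matrix.mul_one]
  simp only [metric, lieInner, Matrix.trace_add, key]

/-- Right invariance. -/
theorem metric_mul_right (p g : U M) (X Y : Matrix (Fin M) (Fin M) ℂ) :
    metric (p * g) (X * g) (Y * g) = metric p X Y := by
  have key : ∀ A : Matrix (Fin M) (Fin M) ℂ, A * (g : Matrix (Fin M) (Fin M) ℂ) *
      (((p * g)⁻¹ : U M) : Matrix (Fin M) (Fin M) ℂ) =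
      A * ((p⁻¹ : U M) : Matrix (Fin M) (Fin M) ℂ) := by
    intro A
    rw [Matrix.mul_assoc, ← Submonoid.coe_mul, _root_.mul_inv_rev, mul_inv_cancel_left]
  simp only [metric, key]

/-- Left invariance. -/
theorem metric_mul_left (p g : U M) (X Y : Matrix (Fin M) (Fin M) ℂ) :
    metric (g * p) (g * X) (g * Y) = metric p X Y := by
  have key : ∀ A B : Matrix (Fin M) (Fin M) ℂ, ((g : Matrix (Fin M) (Fin M) ℂ) * A)ᴴ *
      ((g : Matrix (Fin M) (Fin M) ℂ) * B) = Aᴴ * B := by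
    intro A B
    rw [Matrix.conjTranspose_mul, Matrix.mul_assoc, ← Matrix.mul_assoc _ _ B, inv_mul_self,
      Matrix.one_mul]
  simp only [metric_eq, lieInner, key]

theorem mem_tangentSpace_iff (p : U M) (X : Matrix (Fin M) (Fin M) ℂ) :
    X ∈ tangentSpace p ↔ p * Xᴴ * p = -X := by
  constructor
  · rintro ⟨u, hu, rfl⟩
    have hu' : uᴴ = -u := hu
    simp only [LinearMap.mulRight_apply, Matrix.conjTranspose_mul, hu']
    rw [← Matrix.mul_assoc, mul_inv_self]; simp
  · intro h
    refine ⟨X * (p : Matrix (Fin M) (Fin M) ℂ)ᴴ, ?_, ?_⟩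
    · change (X * (p : Matrix (Fin M) (Fin M) ℂ)ᴴ)ᴴ = -(X * (p : Matrix (Fin M) (Fin M) ℂ)ᴴ)
      rw [← Matrix.neg_mul, ← h, Matrix.mul_assoc, mul_inv_self]; simp
    · simp [Matrix.mul_assoc, inv_mul_self]

theorem tangentProj_mem (p : U M) (X : Matrix (Fin M) (Fin M) ℂ) :
    tangentProj p X ∈ tangentSpace p := by
  rw [mem_tangentSpace_iff, tangentProj]
  have h : (p : Matrix (Fin M) (Fin M) ℂ) *
      ((p : Matrix (Fin M) (Fin M) ℂ) * Xᴴ * (p : Matrix (Fin M) (Fin M) ℂ))ᴴ * p = X := by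
    rw [Matrix.conjTranspose_mul, Matrix.conjTranspose_mul, Matrix.conjTranspose_conjTranspose,
      ← Matrix.mul_assoc, ← Matrix.mul_assoc, mul_inv_self, Matrix.one_mul, Matrix.mul_assoc,
      inv_mul_self, Matrix.mul_one]
  simp only [Matrix.conjTranspose_smul, Matrix.conjTranspose_sub, Matrix.mul_smul,
    Matrix.smul_mul, Matrix.mul_sub, Matrix.sub_mul, h, star_trivial, ← smul_neg, neg_sub]

theorem tangentProj_of_mem (p : U M) {X : Matrix (Fin M) (Fin M) ℂ} (hX : X ∈ tangentSpace p) :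
    tangentProj p X = X := by
  rw [tangentProj, (mem_tangentSpace_iff p X).1 hX, sub_neg_eq_add, smul_add, ← add_smul]
  norm_num

theorem tangentProj_orthogonal (p : U M) (X : Matrix (Fin M) (Fin M) ℂ)
    {Y : Matrix (Fin M) (Fin M) ℂ} (hY : Y ∈ tangentSpace p) :
    lieInner (X - tangentProj p X) Y = 0 := by
  have e1 := mul_inv_self p
  have e2 := inv_mul_self p
  have hY' := (mem_tangentSpace_iff p Y).1 hY
  have hX : X - tangentProj p X = (1 / 2 : ℝ) • (X + (p : Matrix (Fin M) (Fin M) ℂ) * Xᴴ * p) := by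
    rw [tangentProj]; module
  generalize (p : Matrix (Fin M) (Fin M) ℂ) = P at *
  have h1 : ((P * Xᴴ * P : Matrix (Fin M) (Fin M) ℂ)ᴴ * Y).trace = -(Yᴴ * X).trace := by
    have : Y = -(P * Yᴴ * P : Matrix (Fin M) (Fin M) ℂ) := by rw [hY']; simp
    conv_lhs => rw [this]
    simp only [Matrix.conjTranspose_mul, Matrix.conjTranspose_conjTranspose, Matrix.mul_neg,
      Matrix.trace_neg]
    have e : (Pᴴ * (X * Pᴴ) * (P * Yᴴ * P) : Matrix (Fin M) (Fin M) ℂ) =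
        Pᴴ * (X * (Pᴴ * P) * Yᴴ * P) := by simp only [Matrix.mul_assoc]
    rw [e, e2, Matrix.mul_one, Matrix.trace_mul_comm, Matrix.mul_assoc, e1,
      Matrix.mul_one, Matrix.trace_mul_comm]
  have h2 : (Yᴴ * (P * Xᴴ * P : Matrix (Fin M) (Fin M) ℂ)).trace = -(Xᴴ * Y).trace := by
    have e : (Yᴴ * (P * Xᴴ * P) : Matrix (Fin M) (Fin M) ℂ) = (Yᴴ * P * Xᴴ) * P := by
      simp only [Matrix.mul_assoc]
    rw [e, Matrix.trace_mul_comm, ← Matrix.mul_assoc, ← Matrix.mul_assoc, hY', Matrix.neg_mul,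
      Matrix.trace_neg, Matrix.trace_mul_comm]
  rw [hX, lieInner]
  simp only [Matrix.conjTranspose_smul, Matrix.conjTranspose_add, star_trivial, Matrix.smul_mul,
    Matrix.mul_smul, Matrix.add_mul, Matrix.mul_add, Matrix.trace_add, Matrix.trace_smul, h1, h2]
  rw [← smul_add]
  have : (Xᴴ * Y).trace + -(Yᴴ * X).trace + ((Yᴴ * X).trace + -(Xᴴ * Y).trace) = 0 := by ring
  rw [this]; simp

end UnitaryGeodesic

namespace UnitaryGeodesic

/-! The lower bound on lengths is a calibration argument. Since the Frobenius norm is bi-invariant,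
multiplying a competing curve by fixed unitaries makes it run from `1` to `diag (exp (i θ_j))`,
without changing its length. Column `j` then moves on the unit sphere of `ℂ^M`, and its spherical
distance `arccos (Re X_jj)` from the `j`-th basis vector grows no faster than the column moves.
Weighting these distances by `|θ_j|` and applying Cauchy-Schwarz over the columns gives `∑ θ_j² ≤
√(∑ θ_j²) * length` (`sqrt_sum_sq_le_length`); `|θ_j| ≤ π` enters through `arccos (cos |θ_j|) =
|θ_j|`. The exponential curve has constant speed `‖w‖ = √(∑ θ_j²)` and attains the bound
(`isLeast_length_expCurve`). It is a geodesic because its acceleration is normal to the group. -/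

theorem norm_unitary_mul {M : ℕ} (p : U M) (A : Matrix (Fin M) (Fin M) ℂ) :
    ‖(p : Matrix (Fin M) (Fin M) ℂ) * A‖ = ‖A‖ := by
  have h := metric_mul_left 1 p A A
  rw [metric_eq, metric_eq, lieInner_self, lieInner_self] at h
  exact (sq_eq_sq₀ (norm_nonneg _) (norm_nonneg _)).1 h

theorem norm_mul_unitary {M : ℕ} (p : U M) (A : Matrix (Fin M) (Fin M) ℂ) :
    ‖A * (p : Matrix (Fin M) (Fin M) ℂ)‖ = ‖A‖ := by
  have h := metric_mul_right 1 p A A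
  rw [metric_eq, metric_eq, lieInner_self, lieInner_self] at h
  exact (sq_eq_sq₀ (norm_nonneg _) (norm_nonneg _)).1 h

theorem sqrt_metric_self {M : ℕ} (p : U M) (X : Matrix (Fin M) (Fin M) ℂ) :
    √(metric p X X) = ‖X‖ := by
  rw [metric_eq, lieInner_self, Real.sqrt_sq (norm_nonneg _)]

theorem length_eq_integral_norm {M : ℕ} (γ : ℝ → U M) (a b : ℝ) :
    length γ a b = ∫ t in a..b, ‖deriv (toMat γ) t‖ := by
  simp only [length, sqrt_metric_self]

theorem frobenius_norm_sq {M : ℕ} (A : Matrix (Fin M) (Fin M) ℂ) :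
    ‖A‖ ^ 2 = ∑ j, ∑ i, ‖A i j‖ ^ 2 := by
  rw [Matrix.frobenius_norm_def, ← Real.sqrt_eq_rpow, Real.sq_sqrt (by positivity),
    Finset.sum_comm]
  simp only [Real.rpow_two]

/-! ### Speed of the columns on the unit sphere -/

/-- Cauchy-Schwarz on the tangent space of the unit sphere at `x`, where the gradient of the
height function `Re ⟨v, ·⟩` has norm `√(1 - (Re ⟨v, x⟩)²)`. -/
theorem abs_re_inner_le {E : Type*} [NormedAddCommGroup E] [InnerProductSpace ℂ E] {v x y : E}
    (hv : ‖v‖ = 1) (hx : ‖x‖ = 1) (hxy : (inner ℂ x y).re = 0) :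
    |(inner ℂ v y).re| ≤ ‖y‖ * √(1 - (inner ℂ v x).re ^ 2) := by
  set c : ℝ := (inner ℂ v x).re with hc
  -- Only the component of `v` tangent to the sphere at `x` pairs with `y`.
  have h1 : (inner ℂ v y).re = (inner ℂ (v - (c : ℂ) • x) y).re := by
    rw [inner_sub_left, inner_smul_left]
    simp [hxy]
  have h2 : ‖v - (c : ℂ) • x‖ ^ 2 = 1 - c ^ 2 := by
    have := norm_sub_sq (𝕜 := ℂ) v ((c : ℂ) • x)
    rw [this, inner_smul_right, norm_smul, hv, hx]
    simp only [RCLike.re_to_complex, Complex.re_ofReal_mul, ← hc, Complex.norm_real,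
      Real.norm_eq_abs, mul_one, sq_abs]
    ring
  rw [h1, ← h2, Real.sqrt_sq (norm_nonneg _), mul_comm]
  exact (Complex.abs_re_le_norm _).trans (norm_inner_le_norm _ _)

/-- The hypothesis `hXY` is `XᴴX = 1` differentiated. Its `j`-th diagonal entry says that column `j`
of `Y` is tangent to the sphere at column `j` of `X`. -/
theorem abs_re_diag_le {M : ℕ} {X Y : Matrix (Fin M) (Fin M) ℂ} (hX : Xᴴ * X = 1)
    (hXY : Yᴴ * X + Xᴴ * Y = 0) (j : Fin M) :
    |(Y j j).re| ≤ √(∑ i, ‖Y i j‖ ^ 2) * √(1 - (X j j).re ^ 2) := by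
  have hn (A : Matrix (Fin M) (Fin M) ℂ) :
      ‖WithLp.toLp 2 (fun i => A i j)‖ = √(∑ i, ‖A i j‖ ^ 2) := by
    rw [EuclideanSpace.norm_eq]
  have hi (A B : Matrix (Fin M) (Fin M) ℂ) :
      inner ℂ (WithLp.toLp 2 (fun i => A i j)) (WithLp.toLp 2 (fun i => B i j)) =
        (Aᴴ * B) j j := by
    simp [PiLp.inner_apply, Matrix.mul_apply, mul_comm]
  have hs (A : Matrix (Fin M) (Fin M) ℂ) :
      inner ℂ (EuclideanSpace.single j (1 : ℂ)) (WithLp.toLp 2 (fun i => A i j)) = A j j := by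
    rw [EuclideanSpace.inner_single_left]; simp
  have hx : ‖WithLp.toLp 2 (fun i => X i j)‖ = 1 := by
    have h := inner_self_eq_norm_sq_to_K (𝕜 := ℂ) (WithLp.toLp 2 (fun i => X i j))
    rw [hi, hX, Matrix.one_apply_eq] at h
    have h' : ‖WithLp.toLp 2 (fun i => X i j)‖ ^ 2 = 1 := Complex.ofReal_injective (by simpa using h.symm)
    exact (pow_eq_one_iff_of_nonneg (norm_nonneg _) two_ne_zero).1 h'
  have hxy : ((Xᴴ * Y) j j).re = 0 := by
    have h := congrArg Complex.re (congrFun (congrFun hXY j) j)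
    have h3 : (Yᴴ * X) j j = star ((Xᴴ * Y) j j) := by
      rw [← Matrix.conjTranspose_apply, Matrix.conjTranspose_mul, Matrix.conjTranspose_conjTranspose]
    rw [Matrix.add_apply, h3] at h
    simp only [RCLike.star_def, Complex.add_re, Complex.conj_re, Matrix.zero_apply,
      Complex.zero_re] at h
    linarith
  have := abs_re_inner_le (v := EuclideanSpace.single j (1 : ℂ)) (by simp) hx
    (y := WithLp.toLp 2 (fun i => Y i j)) (by rw [hi, hxy])
  rwa [hs, hs, hn] at this

/-- The factor `r < 1` keeps `arccos` away from the points where it is not differentiable. -/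
theorem hasDerivAt_arccos_mul {f : ℝ → ℝ} {f' t r : ℝ} (hf : HasDerivAt f f' t)
    (h1 : |f t| ≤ 1) (hr0 : 0 ≤ r) (hr1 : r < 1) :
    HasDerivAt (fun s => Real.arccos (r * f s))
      (-(1 / √(1 - (r * f t) ^ 2)) * (r * f')) t := by
  have h : |r * f t| < 1 := by
    rw [abs_mul, abs_of_nonneg hr0]
    nlinarith [abs_nonneg (f t)]
  have h' := abs_lt.1 h
  exact HasDerivAt.comp (h₂ := Real.arccos) t (Real.hasDerivAt_arccos h'.1.ne' h'.2.ne)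
    (hf.const_mul r)

/-- Shrinking by `r` only helps: it reduces the numerator and enlarges `√(1 - f ^ 2)` in the
denominator. -/
theorem arccos_mul_deriv_le {f f' r s : ℝ} (hs : 0 ≤ s) (h1 : |f| ≤ 1) (hr0 : 0 ≤ r)
    (hr1 : r < 1) (hf' : |f'| ≤ s * √(1 - f ^ 2)) :
    -(1 / √(1 - (r * f) ^ 2)) * (r * f') ≤ s := by
  have hf2 : f ^ 2 ≤ 1 := (sq_le_one_iff_abs_le_one f).2 h1
  have hr2 : r ^ 2 < 1 := by nlinarith
  have hpos : 0 < 1 - (r * f) ^ 2 := by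
    rw [mul_pow]; nlinarith [sq_nonneg f, sq_nonneg r]
  have hle : √(1 - f ^ 2) ≤ √(1 - (r * f) ^ 2) := by
    apply Real.sqrt_le_sqrt
    rw [mul_pow]; nlinarith [sq_nonneg f]
  have h3 : -(r * f') ≤ s * √(1 - (r * f) ^ 2) :=
    calc -(r * f') ≤ |r * f'| := neg_le_abs _
      _ = r * |f'| := by rw [abs_mul, abs_of_nonneg hr0]
      _ ≤ 1 * |f'| := by gcongr
      _ ≤ s * √(1 - f ^ 2) := by rwa [one_mul]
      _ ≤ _ := by gcongr
  calc _ = -(r * f') / √(1 - (r * f) ^ 2) := by ring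
    _ ≤ s := (div_le_iff₀ (Real.sqrt_pos.2 hpos)).2 h3

theorem hasDerivAt_arccos_sum_le {M : ℕ} {X : ℝ → Matrix (Fin M) (Fin M) ℂ}
    {Y : Matrix (Fin M) (Fin M) ℂ} {t : ℝ} (hX : ∀ s, (X s)ᴴ * X s = 1)
    (hY : HasDerivAt X Y t) {c : Fin M → ℝ} (hc : ∀ j, 0 ≤ c j) {r : ℝ} (hr0 : 0 ≤ r)
    (hr1 : r < 1) :
    ∃ g', HasDerivAt (fun s => ∑ j, c j * Real.arccos (r * (X s j j).re)) g' t ∧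
      g' ≤ √(∑ j, c j ^ 2) * ‖Y‖ := by
  have hXY : Yᴴ * X t + (X t)ᴴ * Y = 0 := by
    have h1 : HasDerivAt (fun s => (X s)ᴴ * X s) (Yᴴ * X t + (X t)ᴴ * Y) t := hY.star.mul hY
    have h2 : (fun s => (X s)ᴴ * X s) = fun _ => 1 := funext hX
    rw [h2] at h1
    exact h1.unique (hasDerivAt_const t _)
  have hentry (j : Fin M) : HasDerivAt (fun s => (X s j j).re) (Y j j).re t := by
    let L : Matrix (Fin M) (Fin M) ℂ →ₗ[ℝ] ℝ :=
      Complex.reLm ∘ₗ (Matrix.entryLinearMap ℝ ℂ j j)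
    exact (L.toContinuousLinearMap.hasFDerivAt (x := X t)).comp_hasDerivAt t hY
  have hle (j : Fin M) : |(X t j j).re| ≤ 1 := by
    refine (Complex.abs_re_le_norm _).trans ?_
    exact entry_norm_bound_of_unitary (𝕜 := ℂ) (Matrix.mem_unitaryGroup_iff'.2 (hX t)) j j
  refine ⟨_, HasDerivAt.fun_sum fun j _ =>
    (hasDerivAt_arccos_mul (hentry j) (hle j) hr0 hr1).const_mul (c j), ?_⟩
  calc _ ≤ ∑ j, c j * √(∑ i, ‖Y i j‖ ^ 2) := by
        refine Finset.sum_le_sum fun j _ => mul_le_mul_of_nonneg_left ?_ (hc j)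
        exact arccos_mul_deriv_le (Real.sqrt_nonneg _) (hle j) hr0 hr1
          (abs_re_diag_le (hX t) hXY j)
    _ ≤ √(∑ j, c j ^ 2) * √(∑ j, √(∑ i, ‖Y i j‖ ^ 2) ^ 2) :=
        Real.sum_mul_le_sqrt_mul_sqrt _ _ _
    _ = √(∑ j, c j ^ 2) * ‖Y‖ := by
        congr 1
        rw [← Real.sqrt_sq (norm_nonneg Y), frobenius_norm_sq]
        congr 1
        exact Finset.sum_congr rfl fun j _ => Real.sq_sqrt (by positivity)

/-! ### Lower bound for the length of a curve -/

/-- The two-sided `deriv` agrees with the continuous `derivWithin` only in the interior; the end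
points are a null set. -/
theorem integrableOn_norm_deriv {E : Type*} [NormedAddCommGroup E] [NormedSpace ℝ E]
    {f : ℝ → E} {a b : ℝ} (hf : ContDiffOn ℝ 1 f (Icc a b)) :
    MeasureTheory.IntegrableOn (fun t => ‖deriv f t‖) (Icc a b) := by
  rcases lt_or_ge a b with hab | hab
  · have h1 : ContinuousOn (fun t => ‖derivWithin f (Icc a b) t‖) (Icc a b) :=
      (hf.continuousOn_derivWithin (uniqueDiffOn_Icc hab) le_rfl).norm
    have h2 := (h1.integrableOn_Icc (μ := MeasureTheory.volume)).mono_set Ioo_subset_Icc_self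
    rw [integrableOn_Icc_iff_integrableOn_Ioo]
    refine h2.congr_fun (fun t ht => ?_) measurableSet_Ioo
    simp only [derivWithin_of_mem_nhds (Icc_mem_nhds ht.1 ht.2)]
  · refine MeasureTheory.IntegrableOn.of_measure_zero ?_
    rw [Real.volume_Icc, ENNReal.ofReal_eq_zero]
    linarith

/-- A weighted sum of the (slightly shrunk) spherical distances from the standard basis vectors to
the columns of `X`. It calibrates the curves in `U(M)`. -/
noncomputable def arccosSum {M : ℕ} (c : Fin M → ℝ) (r : ℝ) (X : Matrix (Fin M) (Fin M) ℂ) : ℝ :=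
  ∑ j, c j * Real.arccos (r * (X j j).re)

theorem arccosSum_sub_le_integral {M : ℕ} (g h : U M) {γ : ℝ → U M} {a b : ℝ} (hab : a ≤ b)
    (hC : ContDiffOn ℝ 1 (toMat γ) (Icc a b)) {c : Fin M → ℝ} (hc : ∀ j, 0 ≤ c j) {r : ℝ}
    (hr0 : 0 ≤ r) (hr1 : r < 1) :
    arccosSum c r (g * γ b * h : U M) - arccosSum c r (g * γ a * h : U M) ≤
      ∫ t in a..b, √(∑ j, c j ^ 2) * ‖deriv (toMat γ) t‖ := by
  have hd : ∀ t ∈ Ioo a b, ∃ g',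
      HasDerivAt (fun s => arccosSum c r (g * γ s * h : U M)) g' t ∧
      g' ≤ √(∑ j, c j ^ 2) * ‖deriv (toMat γ) t‖ := by
    intro t ht
    have h1 : HasDerivAt (toMat γ) (deriv (toMat γ) t) t :=
      ((hC.differentiableOn one_ne_zero).differentiableAt
        (Icc_mem_nhds ht.1 ht.2)).hasDerivAt
    have h2 : HasDerivAt (fun s => ((g * γ s * h : U M) : Matrix (Fin M) (Fin M) ℂ))
        (g * deriv (toMat γ) t * h) t :=
      (h1.const_mul (g : Matrix (Fin M) (Fin M) ℂ)).mul_const (h : Matrix (Fin M) (Fin M) ℂ)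
    have h3 := hasDerivAt_arccos_sum_le (fun s => inv_mul_self (g * γ s * h)) h2 hc hr0 hr1
    rwa [norm_mul_unitary, norm_unitary_mul] at h3
  -- This form of the fundamental theorem needs an integrable majorant of the derivative, not
  -- integrability of the derivative itself.
  refine intervalIntegral.sub_le_integral_of_hasDeriv_right_of_le hab
    (g := fun s => arccosSum c r (g * γ s * h : U M))
    (g' := deriv fun s => arccosSum c r (g * γ s * h : U M)) ?_ ?_
    (MeasureTheory.Integrable.const_mul (integrableOn_norm_deriv hC) _) ?_
  · refine continuousOn_finsetSum _ fun j _ => continuousOn_const.mul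
      (Real.continuous_arccos.comp_continuousOn (continuousOn_const.mul ?_))
    have : Continuous fun A : Matrix (Fin M) (Fin M) ℂ =>
        (((g : Matrix (Fin M) (Fin M) ℂ) * A * (h : Matrix (Fin M) (Fin M) ℂ)) j j).re := by
      fun_prop
    exact this.comp_continuousOn hC.continuousOn
  · intro t ht
    obtain ⟨g', h, -⟩ := hd t ht
    exact h.differentiableAt.hasDerivAt.hasDerivWithinAt
  · intro t ht
    obtain ⟨g', h, h'⟩ := hd t ht
    rwa [h.deriv]

theorem arccosSum_sub_le_length {M : ℕ} (g h : U M) {γ : ℝ → U M} {a b : ℝ}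
    (hγ : IsPiecewiseC1 γ a b) {c : Fin M → ℝ} (hc : ∀ j, 0 ≤ c j) {r : ℝ}
    (hr0 : 0 ≤ r) (hr1 : r < 1) :
    arccosSum c r (g * γ b * h : U M) - arccosSum c r (g * γ a * h : U M) ≤
      √(∑ j, c j ^ 2) * length γ a b := by
  obtain ⟨-, n, τ, hτ, rfl, rfl, hC⟩ := hγ
  have hint : ∀ k < n, IntervalIntegrable
      (fun t => √(∑ j, c j ^ 2) * ‖deriv (toMat γ) t‖) MeasureTheory.volume (τ k) (τ (k + 1)) :=
    fun k hk => (intervalIntegrable_iff_integrableOn_Icc_of_le (hτ k.le_succ)).2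
      (MeasureTheory.Integrable.const_mul (integrableOn_norm_deriv (hC k hk)) _)
  rw [length_eq_integral_norm, ← intervalIntegral.integral_const_mul,
    ← intervalIntegral.sum_integral_adjacent_intervals hint,
    ← Finset.sum_range_sub (fun k => arccosSum c r (g * γ (τ k) * h : U M)) n]
  exact Finset.sum_le_sum fun k hk =>
    arccosSum_sub_le_integral g h (hτ k.le_succ) (hC k (Finset.mem_range.1 hk)) hc hr0 hr1

theorem continuous_arccosSum {M : ℕ} (c : Fin M → ℝ) (X : Matrix (Fin M) (Fin M) ℂ) :
    Continuous fun r => arccosSum c r X :=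
  continuous_finsetSum _ fun _ _ => continuous_const.mul
    (Real.continuous_arccos.comp (continuous_id.mul continuous_const))

theorem sqrt_sum_sq_le_length {M : ℕ} {γ : ℝ → U M} {a b : ℝ} (hab : a ≤ b)
    (hγ : IsPiecewiseC1 γ a b) (V : U M) {θ : Fin M → ℝ} (hθ : ∀ j, |θ j| ≤ Real.pi)
    (hV : ((V⁻¹ * γ b * ((γ a)⁻¹ * V) : U M) : Matrix (Fin M) (Fin M) ℂ) =
      Matrix.diagonal fun j => Complex.exp (θ j * Complex.I)) :
    √(∑ j, θ j ^ 2) ≤ length γ a b := by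
  have hL : 0 ≤ length γ a b := by
    rw [length_eq_integral_norm]
    exact intervalIntegral.integral_nonneg hab fun t _ => norm_nonneg _
  have ha : ((V⁻¹ * γ a * ((γ a)⁻¹ * V) : U M) : Matrix (Fin M) (Fin M) ℂ) = 1 := by
    have : V⁻¹ * γ a * ((γ a)⁻¹ * V) = 1 := by group
    rw [this]; rfl
  have key : ∀ r ∈ Ico (0 : ℝ) 1,
      arccosSum (fun j => |θ j|) r (Matrix.diagonal fun j => Complex.exp (θ j * Complex.I)) -
        arccosSum (fun j => |θ j|) r (1 : Matrix (Fin M) (Fin M) ℂ) ≤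
      √(∑ j, θ j ^ 2) * length γ a b := by
    intro r hr
    have h := arccosSum_sub_le_length V⁻¹ ((γ a)⁻¹ * V) hγ (c := fun j => |θ j|)
      (fun _ => abs_nonneg _) hr.1 hr.2
    rw [hV, ha] at h
    simpa only [sq_abs] using h
  -- Let `r` tend to `1` from below: differentiability was needed only for `r < 1`, while
  -- `arccosSum` is continuous in `r`.
  have hlim := le_of_tendsto
    (((continuous_arccosSum _ _).sub (continuous_arccosSum _ _)).continuousWithinAt
      (s := Iio 1) (x := 1))
    (Filter.mem_of_superset (Ico_mem_nhdsLT zero_lt_one) key)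
  have h1 : arccosSum (fun j => |θ j|) 1 (1 : Matrix (Fin M) (Fin M) ℂ) = 0 := by
    simp [arccosSum]
  have h2 : arccosSum (fun j => |θ j|) 1
      (Matrix.diagonal fun j => Complex.exp (θ j * Complex.I)) = ∑ j, θ j ^ 2 := by
    refine Finset.sum_congr rfl fun j _ => ?_
    rw [one_mul, Matrix.diagonal_apply_eq, Complex.exp_ofReal_mul_I_re, ← Real.cos_abs,
      Real.arccos_cos (abs_nonneg _) (hθ j), ← sq, sq_abs]
  rw [Pi.sub_apply, h1, h2, sub_zero] at hlim
  -- Cancel one factor `√(∑ θ_j²)`; if it vanishes, nonnegativity of the length suffices.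
  rcases (Real.sqrt_nonneg (∑ j, θ j ^ 2)).eq_or_lt with h0 | h0
  · rwa [← h0]
  · refine le_of_mul_le_mul_left ?_ h0
    rwa [Real.mul_self_sqrt (by positivity)]


/-! ### The exponential curve: smoothness, geodesic equation, length -/

theorem hasDerivAt_expCurve {M : ℕ} (w : LieU M) (p : U M) (t : ℝ) :
    HasDerivAt (toMat (expCurve w p))
      ((w : Matrix (Fin M) (Fin M) ℂ) * toMat (expCurve w p) t) t := by
  have h := (hasDerivAt_exp_smul_const' (𝕂 := ℝ) (w : Matrix (Fin M) (Fin M) ℂ) t).mul_const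
    (p : Matrix (Fin M) (Fin M) ℂ)
  rw [Matrix.mul_assoc] at h
  exact h

/-- Bootstrapping along `γ' = w γ`: if `γ` is `C^n`, so is `γ'`. -/
theorem contDiff_expCurve {M : ℕ} (w : LieU M) (p : U M) :
    ContDiff ℝ ∞ (toMat (expCurve w p)) := by
  have h : deriv (toMat (expCurve w p)) =
      fun t => (w : Matrix (Fin M) (Fin M) ℂ) * toMat (expCurve w p) t :=
    funext fun t => (hasDerivAt_expCurve w p t).deriv
  have hd : Differentiable ℝ (toMat (expCurve w p)) :=
    fun t => (hasDerivAt_expCurve w p t).differentiableAt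
  refine contDiff_infty.2 fun n => ?_
  induction n with
  | zero => exact contDiff_zero.2 hd.continuous
  | succ n ih =>
    have h' : ContDiff ℝ n (deriv (toMat (expCurve w p))) := h ▸ contDiff_const.mul ih
    exact contDiff_succ_iff_deriv.2 ⟨hd, by simp, h'⟩

/-- The acceleration is `W² γ` with `W²` Hermitian, whereas tangent vectors at `γ` are
skew-Hermitian matrices times `γ`; the projection therefore kills it. -/
theorem isGeodesic_expCurve {M : ℕ} (w : LieU M) (p : U M) {a b : ℝ} (hab : a < b) :
    IsGeodesic (expCurve w p) a b := by
  refine ⟨(contDiff_expCurve w p).contDiffOn, fun t ht => ?_⟩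
  set W : Matrix (Fin M) (Fin M) ℂ := (w : Matrix (Fin M) (Fin M) ℂ)
  have hu := uniqueDiffOn_Icc hab
  have h1 : ∀ s ∈ Icc a b, derivWithin (toMat (expCurve w p)) (Icc a b) s =
      W * toMat (expCurve w p) s := fun s hs =>
    (hasDerivAt_expCurve w p s).hasDerivWithinAt.derivWithin (hu s hs)
  have h2 : derivWithin (fun s => derivWithin (toMat (expCurve w p)) (Icc a b) s) (Icc a b) t =
      W * (W * toMat (expCurve w p) t) := by
    refine (derivWithin_congr h1 (h1 t ht)).trans ?_
    exact ((hasDerivAt_expCurve w p t).const_mul W).hasDerivWithinAt.derivWithin (hu t ht)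
  have hw : Wᴴ = -W := w.2
  have h3 : toMat (expCurve w p) t * (toMat (expCurve w p) t)ᴴ = 1 := mul_inv_self _
  rw [covDeriv, h2, tangentProj]
  change (1 / 2 : ℝ) • (W * (W * toMat (expCurve w p) t) - toMat (expCurve w p) t *
    (W * (W * toMat (expCurve w p) t))ᴴ * toMat (expCurve w p) t) = 0
  have h4 : toMat (expCurve w p) t * (W * (W * toMat (expCurve w p) t))ᴴ = W * W := by
    rw [Matrix.conjTranspose_mul, Matrix.conjTranspose_mul, hw, ← Matrix.mul_assoc,
      ← Matrix.mul_assoc, h3, Matrix.one_mul, Matrix.neg_mul, Matrix.mul_neg, neg_neg]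
  rw [h4, Matrix.mul_assoc, sub_self, smul_zero]

theorem length_expCurve {M : ℕ} (w : LieU M) (p : U M) (a b : ℝ) :
    length (expCurve w p) a b = (b - a) * ‖(w : Matrix (Fin M) (Fin M) ℂ)‖ := by
  have h : ∀ t, ‖deriv (toMat (expCurve w p)) t‖ = ‖(w : Matrix (Fin M) (Fin M) ℂ)‖ := fun t => by
    have h : deriv (toMat (expCurve w p)) t =
        (w : Matrix (Fin M) (Fin M) ℂ) * toMat (expCurve w p) t := (hasDerivAt_expCurve w p t).deriv
    rw [h]
    exact norm_mul_unitary (expCurve w p t) _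
  simp [length_eq_integral_norm, h]

theorem isPiecewiseC1_of_contDiffOn {M : ℕ} {γ : ℝ → U M} {a b : ℝ} (hab : a ≤ b)
    (h : ContDiffOn ℝ 1 (toMat γ) (Icc a b)) : IsPiecewiseC1 γ a b := by
  refine ⟨h.continuousOn, 1, fun i => if i = 0 then a else b, ?_, by simp, by simp, ?_⟩
  · refine monotone_nat_of_le_succ fun n => ?_
    rcases n with _ | n <;> simp [hab]
  · intro i hi
    obtain rfl : i = 0 := by omega
    simpa using h

theorem expCurve_zero {M : ℕ} (w : LieU M) (p : U M) : expCurve w p 0 = p := by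
  apply Subtype.ext
  simp [expCurve]

/-! ### Diagonalization of the logarithm and minimality -/

theorem IsPrincipalLog.exists_diagonalization {M : ℕ} {w : LieU M} {g : U M}
    (hw : IsPrincipalLog w g) :
    ∃ (V : U M) (θ : Fin M → ℝ), (∀ j, |θ j| ≤ Real.pi) ∧
      (w : Matrix (Fin M) (Fin M) ℂ) = (V : Matrix (Fin M) (Fin M) ℂ) *
        Matrix.diagonal (fun j => (θ j : ℂ) * Complex.I) * ((V⁻¹ : U M) : Matrix (Fin M) (Fin M) ℂ) := by
  obtain ⟨K, hK, hwK, -, hθ⟩ := hw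
  refine ⟨hK.eigenvectorUnitary, hK.eigenvalues, fun j => abs_le.2 ⟨(hθ j).1.le, (hθ j).2⟩, ?_⟩
  have hs : K = (hK.eigenvectorUnitary : Matrix (Fin M) (Fin M) ℂ) *
      Matrix.diagonal (fun j => (hK.eigenvalues j : ℂ)) *
      ((hK.eigenvectorUnitary⁻¹ : U M) : Matrix (Fin M) (Fin M) ℂ) := hK.spectral_theorem
  have hD : Matrix.diagonal (fun j => (hK.eigenvalues j : ℂ) * Complex.I) =
      Complex.I • Matrix.diagonal (fun j => (hK.eigenvalues j : ℂ)) := by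
    rw [← Matrix.diagonal_smul]
    congr 1
    funext j
    simp [mul_comm]
  rw [hwK, hD, Matrix.mul_smul, Matrix.smul_mul, ← hs]

theorem norm_conj_diagonal {M : ℕ} (V : U M) (θ : Fin M → ℝ) :
    ‖(V : Matrix (Fin M) (Fin M) ℂ) * Matrix.diagonal (fun j => (θ j : ℂ) * Complex.I) *
      ((V⁻¹ : U M) : Matrix (Fin M) (Fin M) ℂ)‖ = √(∑ j, θ j ^ 2) := by
  rw [norm_mul_unitary, norm_unitary_mul, Matrix.frobenius_norm_diagonal, EuclideanSpace.norm_eq]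
  simp

theorem exp_smul_conj_diagonal {M : ℕ} (V : U M) (θ : Fin M → ℝ) (t : ℝ) :
    NormedSpace.exp (t • ((V : Matrix (Fin M) (Fin M) ℂ) *
      Matrix.diagonal (fun j => (θ j : ℂ) * Complex.I) *
      ((V⁻¹ : U M) : Matrix (Fin M) (Fin M) ℂ))) =
    (V : Matrix (Fin M) (Fin M) ℂ) *
      Matrix.diagonal (fun j => Complex.exp (((t * θ j : ℝ) : ℂ) * Complex.I)) *
      ((V⁻¹ : U M) : Matrix (Fin M) (Fin M) ℂ) := by
  have hD : t • Matrix.diagonal (fun j => (θ j : ℂ) * Complex.I) =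
      Matrix.diagonal (fun j => ((t * θ j : ℝ) : ℂ) * Complex.I) := by
    rw [← Matrix.diagonal_smul]
    congr 1
    funext j
    simp [mul_assoc]
  let u : (Matrix (Fin M) (Fin M) ℂ)ˣ := Unitary.toUnits V
  have h := Matrix.exp_units_conj u (Matrix.diagonal (fun j => ((t * θ j : ℝ) : ℂ) * Complex.I))
  rw [Matrix.exp_diagonal] at h
  have he : NormedSpace.exp (fun j => ((t * θ j : ℝ) : ℂ) * Complex.I) =
      fun j => Complex.exp (((t * θ j : ℝ) : ℂ) * Complex.I) := by
    funext j
    rw [Pi.coe_exp, Complex.exp_eq_exp_ℂ]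
  rw [he] at h
  rw [← Matrix.smul_mul, ← Matrix.mul_smul, hD]
  exact h

theorem isLeast_length_expCurve {M : ℕ} {w : LieU M} {g : U M} (hw : IsPrincipalLog w g) (p : U M)
    {t : ℝ} (ht : t ∈ Icc (0 : ℝ) 1) :
    IsLeast {L : ℝ | ∃ (γ : ℝ → U M) (a b : ℝ), a ≤ b ∧ IsPiecewiseC1 γ a b ∧
      γ a = p ∧ γ b = expCurve w p t ∧ L = length γ a b} (length (expCurve w p) 0 t) := by
  refine ⟨⟨expCurve w p, 0, t, ht.1, isPiecewiseC1_of_contDiffOn ht.1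
    (((contDiff_expCurve w p).of_le (by simp)).contDiffOn), expCurve_zero w p, rfl, rfl⟩, ?_⟩
  rintro L ⟨γ, a, b, hab, hγ, ha, hb, rfl⟩
  obtain ⟨V, θ, hθ, hwV⟩ := hw.exists_diagonalization
  have hL : length (expCurve w p) 0 t = √(∑ j, (t * θ j) ^ 2) := by
    rw [length_expCurve, hwV, norm_conj_diagonal]
    simp only [mul_pow, ← Finset.mul_sum]
    rw [Real.sqrt_mul (sq_nonneg t), Real.sqrt_sq ht.1, sub_zero]
  rw [hL]
  -- The angles `t * θ j` stay in `[-π, π]` for `t ≤ 1`, so the bound applies directly to every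
  -- initial segment.
  refine sqrt_sum_sq_le_length hab hγ V (fun j => ?_) ?_
  · rw [abs_mul, abs_of_nonneg ht.1]
    exact (mul_le_of_le_one_left (abs_nonneg _) ht.2).trans (hθ j)
  · have hE : expCurve w p t =
        ⟨NormedSpace.exp (t • (w : Matrix (Fin M) (Fin M) ℂ)), exp_mem_unitaryGroup w t⟩ * p := rfl
    -- The factor `p` cancels, leaving `exp (t w)` conjugated into the eigenbasis of `w`.
    have hg : V⁻¹ * γ b * ((γ a)⁻¹ * V) = V⁻¹ *
        ⟨NormedSpace.exp (t • (w : Matrix (Fin M) (Fin M) ℂ)), exp_mem_unitaryGroup w t⟩ * V := by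
      rw [ha, hb, hE]; group
    have hi : ((V⁻¹ : U M) : Matrix (Fin M) (Fin M) ℂ) * (V : Matrix (Fin M) (Fin M) ℂ) = 1 :=
      inv_mul_self V
    rw [hg]
    change ((V⁻¹ : U M) : Matrix (Fin M) (Fin M) ℂ) *
      NormedSpace.exp (t • (w : Matrix (Fin M) (Fin M) ℂ)) * (V : Matrix (Fin M) (Fin M) ℂ) = _
    rw [hwV, exp_smul_conj_diagonal, Matrix.mul_assoc, Matrix.mul_assoc, hi, Matrix.mul_one,
      ← Matrix.mul_assoc, hi, Matrix.one_mul]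

theorem IsPrincipalLog.expCurve_one {M : ℕ} {p q : U M} {w : LieU M}
    (hw : IsPrincipalLog w (q * p⁻¹)) : expCurve w p 1 = q := by
  obtain ⟨K, -, hwK, hexp, -⟩ := hw
  have h : (⟨NormedSpace.exp ((1 : ℝ) • (w : Matrix (Fin M) (Fin M) ℂ)),
      exp_mem_unitaryGroup w 1⟩ : U M) = q * p⁻¹ := Subtype.ext <| by
    change NormedSpace.exp ((1 : ℝ) • (w : Matrix (Fin M) (Fin M) ℂ)) = _
    rw [one_smul, hwK, hexp]
  rw [expCurve, h, inv_mul_cancel_right]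

end UnitaryGeodesic

theorem mainTheorem2 (M : ℕ) (p q : UnitaryGeodesic.U M) (w : UnitaryGeodesic.LieU M)
    (hw : UnitaryGeodesic.IsPrincipalLog w (q * p⁻¹)) :
    UnitaryGeodesic.IsMinimalGeodesicSegment (UnitaryGeodesic.expCurve w p) p q ∧
      UnitaryGeodesic.riemDist p q = ‖(w : Matrix (Fin M) (Fin M) ℂ)‖ := by
  have h0 := UnitaryGeodesic.expCurve_zero w p
  have h1 := hw.expCurve_one
  have hd : ∀ t ∈ Icc (0 : ℝ) 1, UnitaryGeodesic.riemDist p (UnitaryGeodesic.expCurve w p t) =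
      UnitaryGeodesic.length (UnitaryGeodesic.expCurve w p) 0 t := fun t ht =>
    (UnitaryGeodesic.isLeast_length_expCurve hw p ht).csInf_eq
  refine ⟨⟨h0, h1, UnitaryGeodesic.isGeodesic_expCurve w p zero_lt_one, ?_⟩, ?_⟩
  · rwa [h0]
  · have h := hd 1 (right_mem_Icc.2 zero_le_one)
    rwa [h1, UnitaryGeodesic.length_expCurve, sub_zero, one_mul] at h
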